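/- Let $f_0, g_1, \dots, g_{m_2} \colon \mathbb{R}^d \to \mathbb{R}$ be given functions, $I = \{1, \dots, m_1\}$, $J = \{m_1 + 1, \dots, m_2\}$, and consider the problem $$\min f_0(x) \quad \text{s.t.} \quad g_i(x) = 0, \ i \in I, \quad g_j(x) \le 0, \ j \in J, \quad x \in A = \mathbb{R}^d,$$ with feasible set $\Omega$. For $x \in \mathbb{R}^d$ and $p \in \mathbb{R}^{m_2}$ put $\Phi(x, p) = f_0(x)$ if $g_i(x) + p_i = 0$ for all $i \in I$ and $g_j(x) + p_j \le 0$ for all $j \in J$, and $\Phi(x, p) = +\infty$ otherwise; let $f(x) = \Phi(x, 0)$. The proximal Lagrangian is $$\mathscr{L}(x, \lambda, r) = \inf_{p \in \mathbb{R}^{m_2}} \Big( \Phi(x, p) - \langle \lambda, p \rangle + \frac{r}{2} \|p\|^2 \Big) \in [-\infty, +\infty], \qquad \lambda \in \mathbb{R}^{m_2}, \ r \ge 0,$$ and $L(x, \lambda) = f_0(x) + \sum_{s=1}^{m_2} \lambda_s g_s(x)$ is the standard Lagrangian. Let $x^*$ be a locally optimal solution of the problem, that is, $x^* \in \Omega$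 and $x^*$ is a local minimizer of $f_0$ on $\Omega$. Suppose that $f_0$ and all $g_s$, $s \in I \cup J$, are $C^{1,1}$ at $x^*$, i.e. they are differentiable near $x^*$ and their gradients are Lipschitz continuous in a neighbourhood of $x^*$. Let $\lambda^* \in \mathbb{R}^{m_2}$ be such that: 1. $(x^*, \lambda^*)$ is a KKT pair: $\lambda_j^* g_j(x^*) = 0$ and $\lambda_j^* \ge 0$ for all $j \in J$, and $\langle \nabla_x L(x^*, \lambda^*), v \rangle \ge 0$ for all $v$ in the contingent cone to $A$ at $x^*$ (which is $\mathbb{R}^d$); 2. strict complementary slackness holds: there is no $j \in J$ with $g_j(x^*) = 0$ and $\lambda_j^* = 0$; 3. the generalized second order sufficient optimality condition holds: each $M \in \partial^2_{xx} L(x^*, \lambda^*)$ satisfies $\langle v, M v \rangle > 0$ for every nonzero $v \in \mathbb{R}^d$ such that $\langle \nabla g_s(x^*), v \rangle = 0$ for all $s \in I$ and for all $s \in J$ with $g_s(x^*) = 0$ and $\lambda^*_s > 0$. Here $\partial^2_{xx} L(x^*, \lambda^*)$ is the generalized Hessian of $h = L(\cdot, \lambda^*)$ at $x^*$, i.e.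 the convex hull of the set of all matrices $M$ for which there is a sequence $x_n \to x^*$ of points at which $h$ is twice differentiable with $\nabla^2 h(x_n) \to M$. Then $\lambda^*$ is a local augmented Lagrange multiplier at $x^*$: there exists $r_0 \ge 0$ such that for every $r \ge r_0$ the point $x^*$ is a local minimizer of $\mathscr{L}(\cdot, \lambda^*, r)$ on $A = \mathbb{R}^d$, and $\mathscr{L}(x^*, \lambda^*, r) = f(x^*)$. -/

import Mathlib

open Filter Topology

noncomputable section

/-! General duality framework. -/

/-- The augmented Lagrangian
`inf_p (Φ(x, p) - ⟨lam, p⟩ + r σ(p))`, with values in `[-∞, +∞]`,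
of a dualizing parameterization `Φ`, an augmenting function `σ` and a coupling function `c`. -/
def augLagrangian {X P Λ : Type*} (Φ : X → P → EReal) (c : Λ → P → ℝ) (σ : P → ℝ)
    (x : X) (lam : Λ) (r : ℝ) : EReal :=
  ⨅ p : P, (Φ x p - ((c lam p : ℝ) : EReal) + ((r * σ p : ℝ) : EReal))

/-! Functions of class `C^{1,1}` and their generalized Hessians. -/

/-- `h` is `C^{1,1}` at `x`: differentiable near `x`, with a gradient that is Lipschitz continuous
in a neighbourhood of `x`. -/
def IsC11At {d : ℕ} (h : EuclideanSpace ℝ (Fin d) → ℝ) (x : EuclideanSpace ℝ (Fin d)) : Prop :=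
  ∃ U ∈ 𝓝 x, (∀ y ∈ U, DifferentiableAt ℝ h y) ∧ ∃ K : NNReal, LipschitzOnWith K (gradient h) U

/-- `h` is twice differentiable at `x`. -/
def TwiceDifferentiableAt {d : ℕ} (h : EuclideanSpace ℝ (Fin d) → ℝ)
    (x : EuclideanSpace ℝ (Fin d)) : Prop :=
  (∀ᶠ y in 𝓝 x, DifferentiableAt ℝ h y) ∧ DifferentiableAt ℝ (gradient h) x

/-- The Hessian matrix of `h` at `x`: the Jacobian matrix of the gradient. -/
def hessianMatrix {d : ℕ} (h : EuclideanSpace ℝ (Fin d) → ℝ) (x : EuclideanSpace ℝ (Fin d)) :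
    Matrix (Fin d) (Fin d) ℝ :=
  Matrix.of fun i j => (fderiv ℝ (gradient h) x (EuclideanSpace.single j 1)) i

/-- The generalized (Clarke) Hessian of `h` at `x`: the convex hull of all limits of Hessian
matrices of `h` along sequences of points of twice differentiability converging to `x`. -/
def generalizedHessian {d : ℕ} (h : EuclideanSpace ℝ (Fin d) → ℝ)
    (x : EuclideanSpace ℝ (Fin d)) : Set (Matrix (Fin d) (Fin d) ℝ) :=
  convexHull ℝ {M | ∃ u : ℕ → EuclideanSpace ℝ (Fin d),
    Tendsto u atTop (𝓝 x) ∧ (∀ n, TwiceDifferentiableAt h (u n)) ∧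
    Tendsto (fun n => hessianMatrix h (u n)) atTop (𝓝 M)}

/-- The matrix `M` is positive definite on the set `S`. -/
def PosDefOn {d : ℕ} (M : Matrix (Fin d) (Fin d) ℝ) (S : Set (EuclideanSpace ℝ (Fin d))) : Prop :=
  ∀ v ∈ S, v ≠ 0 → 0 < dotProduct v.ofLp (M.mulVec v.ofLp)

/-! Mathematical programming. -/

/-- The problem of minimizing `f₀(x)` subject to `g (inl i) x = 0`, `g (inr j) x ≤ 0`, `x ∈ A`,
with `m` equality constraints, `n` inequality constraints, and a set `A` in `ℝ^d`. -/
structure NLP (d m n : ℕ) where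
  f₀ : EuclideanSpace ℝ (Fin d) → ℝ
  g : Fin m ⊕ Fin n → EuclideanSpace ℝ (Fin d) → ℝ
  A : Set (EuclideanSpace ℝ (Fin d))

namespace NLP

variable {d m n : ℕ} (Q : NLP d m n)

/-- The feasible set. -/
def feasible : Set (EuclideanSpace ℝ (Fin d)) :=
  {x | (∀ i, Q.g (Sum.inl i) x = 0) ∧ (∀ j, Q.g (Sum.inr j) x ≤ 0) ∧ x ∈ Q.A}

/-- `x` is a locally optimal solution. -/
def IsLocallyOptimal (x : EuclideanSpace ℝ (Fin d)) : Prop :=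
  x ∈ Q.feasible ∧ IsLocalMinOn Q.f₀ Q.feasible x

open Classical in
/-- The standard dualizing parameterization: `f₀(x)` if `x` satisfies the functional constraints
shifted by `p`, and `+∞` otherwise. -/
def param (x : EuclideanSpace ℝ (Fin d)) (p : EuclideanSpace ℝ (Fin m ⊕ Fin n)) : EReal :=
  if (∀ i, Q.g (Sum.inl i) x + p (Sum.inl i) = 0) ∧ (∀ j, Q.g (Sum.inr j) x + p (Sum.inr j) ≤ 0)
  then ((Q.f₀ x : ℝ) : EReal) else ⊤

/-- The extended objective function `f = Φ(·, 0)`. -/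
def extObjective (x : EuclideanSpace ℝ (Fin d)) : EReal := Q.param x 0

/-- The proximal (Hestenes-Powell-Rockafellar) Lagrangian: the augmented Lagrangian of the standard
parameterization with the inner product as coupling and `σ(p) = ‖p‖² / 2`. -/
def proxLagrangian (x : EuclideanSpace ℝ (Fin d)) (lam : EuclideanSpace ℝ (Fin m ⊕ Fin n))
    (r : ℝ) : EReal :=
  augLagrangian Q.param (fun l p => inner ℝ l p) (fun p => ‖p‖ ^ 2 / 2) x lam r

/-- `lam` is a local augmented Lagrange multiplier (of the proximal Lagrangian) at `x`. -/
def IsLocalAugMultiplier (x : EuclideanSpace ℝ (Fin d))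
    (lam : EuclideanSpace ℝ (Fin m ⊕ Fin n)) : Prop :=
  ∃ r₀ : ℝ, 0 ≤ r₀ ∧ ∀ r : ℝ, r₀ ≤ r →
    IsLocalMinOn (fun y => Q.proxLagrangian y lam r) Q.A x ∧
    Q.proxLagrangian x lam r = Q.extObjective x

/-- The standard Lagrangian `L(x, lam) = f₀(x) + ∑ₛ lamₛ gₛ(x)`. -/
def lagrangian (x : EuclideanSpace ℝ (Fin d)) (lam : EuclideanSpace ℝ (Fin m ⊕ Fin n)) : ℝ :=
  Q.f₀ x + ∑ s, lam s * Q.g s x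

/-- `(x, lam)` is a KKT pair; `posTangentConeAt` is the contingent cone. -/
def IsKKTPair (x : EuclideanSpace ℝ (Fin d)) (lam : EuclideanSpace ℝ (Fin m ⊕ Fin n)) : Prop :=
  x ∈ Q.feasible ∧
  (∀ j, lam (Sum.inr j) * Q.g (Sum.inr j) x = 0 ∧ 0 ≤ lam (Sum.inr j)) ∧
  ∀ v ∈ posTangentConeAt Q.A x, 0 ≤ inner ℝ (gradient (fun y => Q.lagrangian y lam) x) v

/-- The active inequality constraints with a positive multiplier. -/
def activePos (x : EuclideanSpace ℝ (Fin d)) (lam : EuclideanSpace ℝ (Fin m ⊕ Fin n)) :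
    Set (Fin n) :=
  {j | Q.g (Sum.inr j) x = 0 ∧ 0 < lam (Sum.inr j)}

/-- The active inequality constraints with a zero multiplier. -/
def activeZero (x : EuclideanSpace ℝ (Fin d)) (lam : EuclideanSpace ℝ (Fin m ⊕ Fin n)) :
    Set (Fin n) :=
  {j | Q.g (Sum.inr j) x = 0 ∧ lam (Sum.inr j) = 0}

/-- The strict complementary slackness condition. -/
def StrictComplementarity (x : EuclideanSpace ℝ (Fin d))
    (lam : EuclideanSpace ℝ (Fin m ⊕ Fin n)) : Prop :=
  Q.activeZero x lam = ∅

/-- The subspace of directions orthogonal to the gradients of the equality constraints and of the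
active inequality constraints with a positive multiplier. -/
def tangentSubspace (x : EuclideanSpace ℝ (Fin d)) (lam : EuclideanSpace ℝ (Fin m ⊕ Fin n)) :
    Set (EuclideanSpace ℝ (Fin d)) :=
  {v | (∀ i, inner ℝ (gradient (Q.g (Sum.inl i)) x) v = 0) ∧
    ∀ j ∈ Q.activePos x lam, inner ℝ (gradient (Q.g (Sum.inr j)) x) v = 0}

/-- The generalized second order sufficient optimality condition. -/
def GeneralizedSOSC (x : EuclideanSpace ℝ (Fin d))
    (lam : EuclideanSpace ℝ (Fin m ⊕ Fin n)) : Prop :=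
  ∀ M ∈ generalizedHessian (fun y => Q.lagrangian y lam) x, PosDefOn M (Q.tangentSubspace x lam)

end NLP

end

/-!
At a KKT pair the proximal Lagrangian equals the objective at `x`, so that only its local minimality
at `x` is at stake. The infimum over `p` splits into one-dimensional problems, one for each
constraint, and near `x` it is bounded below by `L(y, lam) + r / 2 * ∑ g s y ^ 2`, where `s` ranges
over the equality constraints and the active inequality constraints with a positive multiplier
(`NLP.IsKKTPair.eventually_le_proxLagrangian`). Since this bound increases with `r` and is equal to
`L(x, lam)` at `x`, it suffices that `x` locally minimizes `h + r * ∑ g s ^ 2` for some `r`, where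
`h = L(·, lam)` is a `C^{1,1}` function with `∇h(x) = 0`
(`IsC11At.exists_eventually_le_add_penalty`). By compactness of the unit sphere this can be checked
near one direction `v` at a time.

* If `v` is not tangent to some `{g s = 0}`, then `g s ^ 2` grows quadratically along the directions
  near `v`, while `h` decreases at most quadratically; a large `r` settles the matter.
* If `v` is tangent, the generalized Hessian of `h` is positive in the direction `v`. As the
  Hessians of `h` near `x` are bounded, a compactness argument shows that they are nonnegative in
  the directions near `v`, at all points near `x` where they exist. These points have full measure
  by Rademacher's theorem, hence full measure on almost every line of a given direction by Fubini's
  theorem; it follows that the gradient of `h` is monotone along such lines, and by continuity along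
  all lines (`LipschitzOnWith.inner_le_inner_add_of_fderiv_nonneg`). So `h` does not decrease when
  one leaves `x` in a direction near `v` (`IsC11At.exists_le_add_smul`).
-/

open MeasureTheory Metric Set

/-! ### Lipschitz maps with positive semidefinite derivatives -/

theorem LipschitzOnWith.le_of_ae_deriv_nonneg {φ : ℝ → ℝ} {a b : ℝ} {K : NNReal} (hab : a ≤ b)
    (hφ : LipschitzOnWith K φ (Icc a b)) (hd : ∀ᵐ s : ℝ, s ∈ Icc a b → 0 ≤ deriv φ s) :
    φ a ≤ φ b := by
  have hac : AbsolutelyContinuousOnInterval φ a b :=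
    LipschitzOnWith.absolutelyContinuousOnInterval (K := K) (by rwa [uIcc_of_le hab])
  rw [← sub_nonneg, ← hac.integral_deriv_eq_sub]
  exact intervalIntegral.integral_nonneg_of_ae_restrict hab
    ((ae_restrict_iff' measurableSet_Icc).2 hd)

section Rademacher

variable {E : Type*} [NormedAddCommGroup E] [InnerProductSpace ℝ E] [FiniteDimensional ℝ E]
  [MeasurableSpace E] [BorelSpace E]

/-- Almost every line parallel to `w` meets a null set in a null set. -/
theorem ae_ae_add_smul_of_ae {μ : Measure E} [μ.IsAddHaarMeasure] {p : E → Prop}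
    (hp : ∀ᵐ z ∂μ, p z) (w : E) : ∀ᵐ y ∂μ, ∀ᵐ s : ℝ, p (y + s • w) := by
  obtain ⟨N, hN, hNm, hN0⟩ := exists_measurable_superset_of_null (ae_iff.1 hp)
  have hm : MeasurableSet {q : ℝ × E | q.2 + q.1 • w ∉ N} := by
    have : Measurable fun q : ℝ × E => q.2 + q.1 • w := by fun_prop
    exact this hNm.compl
  have hs : ∀ᵐ s : ℝ, ∀ᵐ y ∂μ, y + s • w ∉ N := by
    refine ae_of_all _ fun s => ?_
    exact (measurePreserving_add_right μ (s • w)).quasiMeasurePreserving.ae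
      (measure_eq_zero_iff_ae_notMem.1 hN0)
  filter_upwards [(Measure.ae_ae_comm (p := fun s y => y + s • w ∉ N) hm).1 hs] with y hy
  filter_upwards [hy] with s h
  by_contra hc
  exact h (hN hc)

/-- A Lipschitz map is monotone in the direction `w` as soon as its derivative is nonnegative on
`w` at every point where it exists. The segment `[x, x + w]` itself may consist of points of
nondifferentiability; by Rademacher's theorem and Fubini's theorem almost every translate of it
does not, and the inequality passes to the limit. -/
theorem LipschitzOnWith.inner_le_inner_add_of_fderiv_nonneg {G : E → E} {U : Set E} {K : NNReal}
    (hG : LipschitzOnWith K G U) (hU : IsOpen U) (hUc : Convex ℝ U) {x w : E}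
    (hx : x ∈ U) (hxw : x + w ∈ U)
    (hpos : ∀ z ∈ U, DifferentiableAt ℝ G z → 0 ≤ inner ℝ (fderiv ℝ G z w) w) :
    inner ℝ (G x) w ≤ inner ℝ (G (x + w)) w := by
  have hdiff : ∀ᵐ z ∂(volume : Measure E), z ∈ U → DifferentiableAt ℝ G z := by
    filter_upwards [hG.ae_differentiableWithinAt_of_mem (μ := (volume : Measure E))] with z hz hzU
    exact (hz hzU).differentiableAt (hU.mem_nhds hzU)
  have hgood : ∀ᵐ y ∂(volume : Measure E), y ∈ U → y + w ∈ U →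
      inner ℝ (G y) w ≤ inner ℝ (G (y + w)) w := by
    filter_upwards [ae_ae_add_smul_of_ae hdiff w] with y hy hyU hywU
    have hseg : ∀ s ∈ Icc (0 : ℝ) 1, y + s • w ∈ U := fun s hs =>
      hUc.add_smul_mem hyU hywU hs
    have hline : LipschitzWith ‖w‖₊ fun s : ℝ => y + s • w := by
      refine LipschitzWith.of_dist_le_mul fun s t => ?_
      rw [dist_add_left, dist_eq_norm, ← sub_smul, norm_smul, dist_eq_norm, mul_comm]
      rfl
    have hlip := ((innerSL ℝ w).lipschitz.comp_lipschitzOnWith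
      (hG.comp (hline.lipschitzOnWith (s := Icc (0 : ℝ) 1)) hseg))
    have hder : ∀ᵐ s : ℝ, s ∈ Icc (0 : ℝ) 1 →
        0 ≤ deriv (innerSL ℝ w ∘ G ∘ fun s : ℝ => y + s • w) s := by
      filter_upwards [hy] with s hs hsI
      have hd := hs (hseg s hsI)
      have h1 : HasDerivAt (fun s : ℝ => y + s • w) w s := by
        simpa using ((hasDerivAt_id s).smul_const w).const_add y
      have h2 := (innerSL ℝ w).hasFDerivAt.comp_hasDerivAt s
        (hd.hasFDerivAt.comp_hasDerivAt s h1)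
      rw [h2.deriv, innerSL_apply_apply, real_inner_comm]
      exact hpos _ (hseg s hsI) hd
    have := hlip.le_of_ae_deriv_nonneg zero_le_one hder
    simpa [real_inner_comm w] using this
  have hfreq : ∃ᶠ y in 𝓝 x, y ∈ U → y + w ∈ U → inner ℝ (G y) w ≤ inner ℝ (G (y + w)) w :=
    mem_closure_iff_frequently.1 (Measure.dense_of_ae hgood x)
  have hadd : Tendsto (fun y => y + w) (𝓝 x) (𝓝 (x + w)) :=
    (continuous_id.add continuous_const).tendsto x
  have c1 : ContinuousAt (fun y => inner ℝ (G y) w) x :=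
    (hG.continuousOn.continuousAt (hU.mem_nhds hx)).inner continuousAt_const
  have c2 : Tendsto (fun y => inner ℝ (G (y + w)) w) (𝓝 x) (𝓝 (inner ℝ (G (x + w)) w)) :=
    ((hG.continuousOn.continuousAt (hU.mem_nhds hxw)).tendsto.comp hadd).inner tendsto_const_nhds
  by_contra! hlt
  obtain ⟨y, hy, hyU, hywU, hylt⟩ := (hfreq.and_eventually
    ((hU.eventually_mem hx).and ((hadd.eventually (hU.eventually_mem hxw)).and
      (c2.eventually_lt c1 hlt)))).exists
  exact absurd (hy hyU hywU) (not_le.2 hylt)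

end Rademacher

/-! ### Functions of class `C^{1,1}` -/

section C11

variable {d : ℕ}

local notation "E" => EuclideanSpace ℝ (Fin d)

theorem IsC11At.exists_ball {h : E → ℝ} {x : E} (hh : IsC11At h x) :
    ∃ ρ > 0, (∀ y ∈ ball x ρ, DifferentiableAt ℝ h y) ∧
      ∃ K : NNReal, LipschitzOnWith K (gradient h) (ball x ρ) := by
  obtain ⟨U, hU, hd, K, hK⟩ := hh
  obtain ⟨ρ, hρ, hsub⟩ := Metric.mem_nhds_iff.1 hU
  exact ⟨ρ, hρ, fun y hy => hd y (hsub hy), K, hK.mono hsub⟩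

theorem IsC11At.differentiableAt {h : E → ℝ} {x : E} (hh : IsC11At h x) :
    DifferentiableAt ℝ h x := by
  obtain ⟨U, hU, hd, -⟩ := hh
  exact hd x (mem_of_mem_nhds hU)

theorem IsC11At.add {f h : E → ℝ} {x : E} (hf : IsC11At f x) (hh : IsC11At h x) :
    IsC11At (fun y => f y + h y) x := by
  obtain ⟨U, hU, hdU, K, hK⟩ := hf
  obtain ⟨V, hV, hdV, K', hK'⟩ := hh
  refine ⟨U ∩ V, inter_mem hU hV, fun y hy => (hdU y hy.1).add (hdV y hy.2), K + K', ?_⟩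
  have hadd := (hK.mono inter_subset_left).add (hK'.mono (inter_subset_right (s := U)))
  have hgrad : ∀ y ∈ U ∩ V, gradient (fun y => f y + h y) y = gradient f y + gradient h y := by
    refine fun y hy => HasGradientAt.gradient ?_
    rw [hasGradientAt_iff_hasFDerivAt, map_add]
    exact (hdU y hy.1).hasGradientAt.hasFDerivAt.add (hdV y hy.2).hasGradientAt.hasFDerivAt
  intro y hy z hz
  rw [hgrad y hy, hgrad z hz]
  exact hadd hy hz

theorem IsC11At.const_mul {f : E → ℝ} {x : E} (hf : IsC11At f x) (c : ℝ) :
    IsC11At (fun y => c * f y) x := by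
  obtain ⟨U, hU, hdU, K, hK⟩ := hf
  refine ⟨U, hU, fun y hy => (hdU y hy).const_mul c, ‖c‖₊ * K, ?_⟩
  have hsmul := (lipschitzWith_smul c).comp_lipschitzOnWith hK
  have hgrad : ∀ y ∈ U, gradient (fun y => c * f y) y = c • gradient f y := by
    refine fun y hy => HasGradientAt.gradient ?_
    rw [hasGradientAt_iff_hasFDerivAt]
    simpa using (hdU y hy).hasGradientAt.hasFDerivAt.const_mul c
  intro y hy z hz
  rw [hgrad y hy, hgrad z hz]
  exact hsmul hy hz

theorem isC11At_const (c : ℝ) (x : E) : IsC11At (fun _ => c) x := by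
  refine ⟨univ, univ_mem, fun y _ => differentiableAt_const c, 0, ?_⟩
  have h0 : gradient (fun _ : E => c) = fun _ => 0 := by
    ext1 y
    simp [gradient]
  rw [h0]
  exact (LipschitzWith.const (0 : E)).lipschitzOnWith

theorem IsC11At.sum {ι : Type*} {f : ι → E → ℝ} {x : E} (s : Finset ι)
    (hf : ∀ i, IsC11At (f i) x) : IsC11At (fun y => ∑ i ∈ s, f i y) x := by
  classical
  induction s using Finset.induction_on with
  | empty => simpa using isC11At_const 0 x
  | insert i s hi ih => simpa [Finset.sum_insert hi] using (hf i).add ih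

/-- At a critical point, a `C^{1,1}` function varies at most quadratically. -/
theorem IsC11At.exists_abs_sub_le {h : E → ℝ} {x : E} (hh : IsC11At h x)
    (h0 : gradient h x = 0) :
    ∃ K : ℝ, 0 ≤ K ∧ ∀ᶠ y in 𝓝 x, |h y - h x| ≤ K * ‖y - x‖ ^ 2 := by
  obtain ⟨ρ, hρ, hd, K, hK⟩ := hh.exists_ball
  refine ⟨K, K.2, ?_⟩
  filter_upwards [ball_mem_nhds x hρ] with y hy
  have hsub : closedBall x ‖y - x‖ ⊆ ball x ρ :=
    closedBall_subset_ball (by rwa [← dist_eq_norm])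
  have hbound : ∀ z ∈ closedBall x ‖y - x‖, ‖fderiv ℝ h z‖ ≤ K * ‖y - x‖ := by
    intro z hz
    have h1 := hK.norm_sub_le (hsub hz) (mem_ball_self hρ)
    rw [h0, sub_zero] at h1
    rw [← toDual_gradient, LinearIsometryEquiv.norm_map]
    refine h1.trans (mul_le_mul_of_nonneg_left ?_ K.2)
    rwa [mem_closedBall, dist_eq_norm] at hz
  have := (convex_closedBall x ‖y - x‖).norm_image_sub_le_of_norm_fderiv_le
    (fun z hz => hd z (hsub hz)) hbound (mem_closedBall_self (norm_nonneg _))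
    (show y ∈ closedBall x ‖y - x‖ by rw [mem_closedBall, dist_eq_norm])
  calc |h y - h x| ≤ K * ‖y - x‖ * ‖y - x‖ := this
    _ = K * ‖y - x‖ ^ 2 := by ring

theorem dotProduct_mulVec_eq_inner (A : E →L[ℝ] E) (w : E) :
    dotProduct w.ofLp ((Matrix.of fun i j => (A (EuclideanSpace.single j 1)) i).mulVec w.ofLp) =
      inner ℝ (A w) w := by
  have hw : w = ∑ j, w j • EuclideanSpace.single j (1 : ℝ) := by
    ext i
    simp [Pi.single_apply]
  have hA : ∀ i, (A w) i = ∑ j, (A (EuclideanSpace.single j 1)) i * w j := by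
    intro i
    conv_lhs => rw [hw]
    simp [mul_comm]
  simp only [PiLp.inner_apply, hA]
  simp [dotProduct, Matrix.mulVec]

/-- Positivity of the generalized Hessian at `x` in the direction `v` spreads to the Hessians at
nearby points, in nearby directions: near `x` these are bounded by the Lipschitz constant of the
gradient, so that a sequence of counterexamples would have a cluster point in the generalized
Hessian. -/
theorem IsC11At.eventually_hessian_nonneg {h : E → ℝ} {x v : E} (hh : IsC11At h x)
    (hv : ∀ M ∈ generalizedHessian h x, 0 < dotProduct v.ofLp (M.mulVec v.ofLp)) :
    ∀ᶠ q : E × E in 𝓝 (x, v), TwiceDifferentiableAt h q.1 →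
      0 ≤ inner ℝ (fderiv ℝ (gradient h) q.1 q.2) q.2 := by
  by_contra hcon
  obtain ⟨ρ, hρ, hd, K, hK⟩ := hh.exists_ball
  have hfr := (Filter.not_eventually.1 hcon).and_eventually
    (continuousAt_fst.eventually (isOpen_ball.mem_nhds (mem_ball_self hρ)))
  obtain ⟨u, hu, hup⟩ := exists_seq_forall_of_frequently hfr
  replace hup : ∀ k, (TwiceDifferentiableAt h (u k).1 ∧
      inner ℝ (fderiv ℝ (gradient h) (u k).1 (u k).2) (u k).2 < 0) ∧ (u k).1 ∈ ball x ρ :=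
    fun k => ⟨by simpa only [Classical.not_imp, not_le] using (hup k).1, (hup k).2⟩
  have hcpt : IsCompact (closedBall (0 : E →L[ℝ] E) K) :=
    haveI := FiniteDimensional.proper ℝ (E →L[ℝ] E)
    isCompact_closedBall _ _
  obtain ⟨A, -, σ, hσ, hA⟩ := hcpt.tendsto_subseq (x := fun k => fderiv ℝ (gradient h) (u k).1)
    fun k => by
      rw [mem_closedBall_zero_iff]
      exact norm_fderiv_le_of_lipschitzOn ℝ (isOpen_ball.mem_nhds (hup k).2) hK
  have hu1 : Tendsto (fun k => (u (σ k)).1) atTop (𝓝 x) :=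
    (continuous_fst.tendsto (x, v)).comp (hu.comp hσ.tendsto_atTop)
  have hu2 : Tendsto (fun k => (u (σ k)).2) atTop (𝓝 v) :=
    (continuous_snd.tendsto (x, v)).comp (hu.comp hσ.tendsto_atTop)
  set M : Matrix (Fin d) (Fin d) ℝ := Matrix.of fun i j => (A (EuclideanSpace.single j 1)) i
    with hM
  have hMlim : Tendsto (fun k => hessianMatrix h (u (σ k)).1) atTop (𝓝 M) := by
    refine tendsto_pi_nhds.2 fun i => tendsto_pi_nhds.2 fun j => ?_
    have hc : Continuous fun B : E →L[ℝ] E => (B (EuclideanSpace.single j 1)) i := by fun_prop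
    exact (hc.tendsto A).comp hA
  have hmem : M ∈ generalizedHessian h x :=
    subset_convexHull ℝ _ ⟨fun k => (u (σ k)).1, hu1, fun k => (hup (σ k)).1.1, hMlim⟩
  have hlim : Tendsto (fun k => inner ℝ (fderiv ℝ (gradient h) (u (σ k)).1 (u (σ k)).2)
      (u (σ k)).2) atTop (𝓝 (inner ℝ (A v) v)) :=
    ((isBoundedBilinearMap_apply.continuous.tendsto (A, v)).comp (hA.prodMk_nhds hu2)).inner hu2
  have hMv := hv M hmem
  rw [hM, dotProduct_mulVec_eq_inner] at hMv
  exact absurd hMv (not_lt.2 (le_of_tendsto hlim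
    (Eventually.of_forall fun k => (hup (σ k)).1.2.le)))

/-- If the generalized Hessian at a critical point `x` is positive in the direction `v`, then `x`
minimizes the function along short segments issuing from `x` in directions close to `v`. -/
theorem IsC11At.exists_le_add_smul {h : E → ℝ} {x v : E} (hh : IsC11At h x)
    (h0 : gradient h x = 0)
    (hv : ∀ M ∈ generalizedHessian h x, 0 < dotProduct v.ofLp (M.mulVec v.ofLp)) :
    ∃ V ∈ 𝓝 v, ∃ δ > 0, ∀ w ∈ V, ‖w‖ = 1 → ∀ t ∈ Icc (0 : ℝ) δ, h x ≤ h (x + t • w) := by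
  obtain ⟨ρ, hρ, hd, K, hK⟩ := hh.exists_ball
  have hev := hh.eventually_hessian_nonneg hv
  rw [nhds_prod_eq] at hev
  obtain ⟨P, hP, V, hV, hPV⟩ := Filter.eventually_prod_iff.1 hev
  obtain ⟨ε, hε, hεP⟩ := Metric.mem_nhds_iff.1 hP
  set η := min ρ ε
  have hη : 0 < η := lt_min hρ hε
  refine ⟨{w | V w}, hV, η / 2, half_pos hη, fun w hw hw1 t ht => ?_⟩
  have hmem : ∀ s ∈ Icc (0 : ℝ) (η / 2), x + s • w ∈ ball x η := by
    intro s hs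
    rw [mem_ball, dist_self_add_left, norm_smul, hw1, mul_one, Real.norm_of_nonneg hs.1]
    linarith [hs.2]
  have hdiff : ∀ z ∈ ball x η, DifferentiableAt ℝ h z := fun z hz =>
    hd z (ball_subset_ball (min_le_left _ _) hz)
  have hgrad : ∀ s ∈ Icc (0 : ℝ) (η / 2), 0 ≤ inner ℝ (gradient h (x + s • w)) w := by
    intro s hs
    rcases hs.1.eq_or_lt with rfl | hs0
    · simp [h0]
    have hmono := (hK.mono (ball_subset_ball (min_le_left ρ ε))).inner_le_inner_add_of_fderiv_nonneg
      isOpen_ball (convex_ball x η) (mem_ball_self hη) (hmem s hs) fun z hz hz' => by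
        have := hPV (hεP (ball_subset_ball (min_le_right _ _) hz)) hw
          ⟨(isOpen_ball.eventually_mem hz).mono hdiff, hz'⟩
        rw [map_smul, inner_smul_left, inner_smul_right]
        exact mul_nonneg hs0.le (mul_nonneg hs0.le this)
    rw [h0, inner_zero_left, inner_smul_right] at hmono
    exact nonneg_of_mul_nonneg_right hmono hs0
  have hder : ∀ s ∈ Icc (0 : ℝ) (η / 2),
      HasDerivAt (fun s : ℝ => h (x + s • w)) (inner ℝ (gradient h (x + s • w)) w) s := by
    intro s hs
    have h1 : HasDerivAt (fun s : ℝ => x + s • w) w s := by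
      simpa using ((hasDerivAt_id s).smul_const w).const_add x
    simpa [Function.comp_def] using
      (hdiff _ (hmem s hs)).hasGradientAt.hasFDerivAt.comp_hasDerivAt s h1
  have hmono : MonotoneOn (fun s : ℝ => h (x + s • w)) (Icc 0 (η / 2)) := by
    refine monotoneOn_of_deriv_nonneg (convex_Icc _ _)
      (fun s hs => (hder s hs).continuousAt.continuousWithinAt)
      (fun s hs => (hder s (interior_subset hs)).differentiableAt.differentiableWithinAt)
      fun s hs => ?_
    rw [(hder s (interior_subset hs)).deriv]
    exact hgrad s (interior_subset hs)
  simpa using hmono (left_mem_Icc.2 (half_pos hη).le) ht ht.1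

/-! ### The quadratic penalty -/

/-- Along directions `w` close to a direction `v` that is not tangent to `{g = 0}`, the function
`g` grows at least linearly. -/
theorem exists_mul_le_abs_add_smul {g : E → ℝ} {x v : E}
    (hg : DifferentiableAt ℝ g x) (hgx : g x = 0) (hv : inner ℝ (gradient g x) v ≠ 0) :
    ∃ c > 0, ∃ V ∈ 𝓝 v, ∃ δ > 0, ∀ w ∈ V, ‖w‖ = 1 → ∀ t ∈ Icc (0 : ℝ) δ,
      c * t ≤ |g (x + t • w)| := by
  set a := |inner ℝ (gradient g x) v|
  have ha : 0 < a := abs_pos.2 hv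
  have hV : ∀ᶠ w in 𝓝 v, a / 2 < |inner ℝ (gradient g x) w| := by
    have hc : Continuous fun w : E => |inner ℝ (gradient g x) w| := by fun_prop
    exact (hc.tendsto v).eventually (lt_mem_nhds (half_lt_self ha))
  have hlo := hg.hasGradientAt.hasFDerivAt.isLittleO.def (show 0 < a / 4 by positivity)
  obtain ⟨ρ, hρ, hlo⟩ := Metric.eventually_nhds_iff.1 hlo
  refine ⟨a / 4, by positivity, _, hV, ρ / 2, half_pos hρ, fun w hw hw1 t ht => ?_⟩
  have hnorm : ‖t • w‖ = t := by rw [norm_smul, hw1, mul_one, Real.norm_of_nonneg ht.1]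
  have h1 := @hlo (x + t • w) (by
    rw [dist_self_add_left, hnorm]
    linarith [ht.2])
  simp only [hgx, sub_zero, add_sub_cancel_left, hnorm, InnerProductSpace.toDual_apply_apply,
    inner_smul_right, Real.norm_eq_abs] at h1
  have h2 : |t * inner ℝ (gradient g x) w| = t * |inner ℝ (gradient g x) w| := by
    rw [abs_mul, abs_of_nonneg ht.1]
  have h3 := abs_sub_abs_le_abs_sub (t * inner ℝ (gradient g x) w) (g (x + t • w))
  rw [abs_sub_comm, h2] at h3
  have h4 := mul_le_mul_of_nonneg_left (le_of_lt hw) ht.1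
  linarith

/-- If the generalized Hessian of `h` at a critical point `x` is positive on the nonzero directions
tangent to all the `{g s = 0}`, then `x` locally minimizes `h` plus a multiple of the sum of the
`g s ^ 2`. The multiple is found direction by direction, by compactness of the unit sphere. -/
theorem IsC11At.exists_eventually_le_add_penalty {ι : Type*} {h : E → ℝ} {x : E} {S : Finset ι}
    {g : ι → E → ℝ} (hh : IsC11At h x) (h0 : gradient h x = 0)
    (hg : ∀ s ∈ S, DifferentiableAt ℝ (g s) x) (hgx : ∀ s ∈ S, g s x = 0)
    (hpos : ∀ v, (∀ s ∈ S, inner ℝ (gradient (g s) x) v = 0) → v ≠ 0 →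
      ∀ M ∈ generalizedHessian h x, 0 < dotProduct v.ofLp (M.mulVec v.ofLp)) :
    ∃ r : ℝ, 0 ≤ r ∧ ∀ᶠ y in 𝓝 x, h x ≤ h y + r * ∑ s ∈ S, g s y ^ 2 := by
  have hsum : ∀ y, 0 ≤ ∑ s ∈ S, g s y ^ 2 := fun y => Finset.sum_nonneg fun s _ => sq_nonneg _
  suffices hsph : ∃ r : ℝ, 0 ≤ r ∧ ∃ δ > 0, ∀ w ∈ sphere (0 : E) 1, ∀ t ∈ Icc (0 : ℝ) δ,
      h x ≤ h (x + t • w) + r * ∑ s ∈ S, g s (x + t • w) ^ 2 by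
    obtain ⟨r, hr, δ, hδ, H⟩ := hsph
    refine ⟨r, hr, ?_⟩
    filter_upwards [ball_mem_nhds x hδ] with y hy
    rcases eq_or_ne y x with rfl | hne
    · exact le_add_of_nonneg_right (mul_nonneg hr (hsum y))
    have hpos' : 0 < ‖y - x‖ := norm_pos_iff.2 (sub_ne_zero.2 hne)
    have := H (‖y - x‖⁻¹ • (y - x)) (by
      rw [mem_sphere_zero_iff_norm, norm_smul, norm_inv, norm_norm, inv_mul_cancel₀ hpos'.ne'])
      ‖y - x‖ ⟨hpos'.le, by rw [← dist_eq_norm]; exact (mem_ball.1 hy).le⟩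
    rwa [smul_smul, mul_inv_cancel₀ hpos'.ne', one_smul, add_sub_cancel] at this
  refine (isCompact_sphere (0 : E) 1).induction_on (p := fun V => ∃ r : ℝ, 0 ≤ r ∧ ∃ δ > 0,
    ∀ w ∈ V, ∀ t ∈ Icc (0 : ℝ) δ, h x ≤ h (x + t • w) + r * ∑ s ∈ S, g s (x + t • w) ^ 2)
    ⟨0, le_rfl, 1, one_pos, by simp⟩ ?_ ?_ ?_
  · rintro V W hVW ⟨r, hr, δ, hδ, H⟩
    exact ⟨r, hr, δ, hδ, fun w hw => H w (hVW hw)⟩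
  · rintro V W ⟨r, hr, δ, hδ, H⟩ ⟨r', hr', δ', hδ', H'⟩
    refine ⟨max r r', le_max_of_le_left hr, min δ δ', lt_min hδ hδ', ?_⟩
    rintro w (hw | hw) t ht
    · refine (H w hw t ⟨ht.1, ht.2.trans (min_le_left _ _)⟩).trans ?_
      exact add_le_add_right (mul_le_mul_of_nonneg_right (le_max_left _ _) (hsum _)) _
    · refine (H' w hw t ⟨ht.1, ht.2.trans (min_le_right _ _)⟩).trans ?_
      exact add_le_add_right (mul_le_mul_of_nonneg_right (le_max_right _ _) (hsum _)) _
  · intro v hv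
    by_cases hT : ∀ s ∈ S, inner ℝ (gradient (g s) x) v = 0
    · obtain ⟨V, hV, δ, hδ, H⟩ := hh.exists_le_add_smul h0
        (hpos v hT (ne_zero_of_mem_unit_sphere ⟨v, hv⟩))
      refine ⟨V ∩ sphere 0 1, inter_mem (mem_nhdsWithin_of_mem_nhds hV) self_mem_nhdsWithin,
        0, le_rfl, δ, hδ, fun w hw t ht => ?_⟩
      simpa using H w hw.1 (mem_sphere_zero_iff_norm.1 hw.2) t ht
    · push Not at hT
      obtain ⟨s, hs, hsv⟩ := hT
      obtain ⟨c, hc, V, hV, δ, hδ, H⟩ := exists_mul_le_abs_add_smul (hg s hs) (hgx s hs) hsv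
      obtain ⟨K, hK, hquad⟩ := hh.exists_abs_sub_le h0
      obtain ⟨ρ, hρ, hquad⟩ := Metric.eventually_nhds_iff.1 hquad
      -- `r = K / c ^ 2` makes the penalty at least `K t ^ 2`, which dominates the decrease of `h`.
      refine ⟨V ∩ sphere 0 1, inter_mem (mem_nhdsWithin_of_mem_nhds hV) self_mem_nhdsWithin,
        K / c ^ 2, by positivity, min δ (ρ / 2), lt_min hδ (half_pos hρ), fun w hw t ht => ?_⟩
      have hw1 := mem_sphere_zero_iff_norm.1 hw.2
      have hnorm : ‖t • w‖ = t := by rw [norm_smul, hw1, mul_one, Real.norm_of_nonneg ht.1]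
      have h1 := H w hw.1 hw1 t ⟨ht.1, ht.2.trans (min_le_left _ _)⟩
      have h2 := @hquad (x + t • w) (by
        rw [dist_self_add_left, hnorm]
        linarith [ht.2.trans (min_le_right _ _)])
      rw [add_sub_cancel_left, hnorm] at h2
      have h3 : (c * t) ^ 2 ≤ ∑ s ∈ S, g s (x + t • w) ^ 2 := by
        refine le_trans ?_ (Finset.single_le_sum (f := fun s => g s (x + t • w) ^ 2)
          (fun s _ => sq_nonneg _) hs)
        rw [← sq_abs (g s (x + t • w))]
        exact pow_le_pow_left₀ (mul_nonneg hc.le ht.1) h1 2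
      have h4 : K * t ^ 2 ≤ K / c ^ 2 * ∑ s ∈ S, g s (x + t • w) ^ 2 := by
        refine le_trans (le_of_eq ?_) (mul_le_mul_of_nonneg_left h3 (by positivity))
        field_simp
      linarith [(abs_le.1 h2).1]

end C11

/-! ### The proximal Lagrangian -/

namespace NLP

variable {d m n : ℕ} (Q : NLP d m n)

/-- A bound from below for the proximal Lagrangian is a bound from below for the penalized
objective at all perturbations that make the point feasible. -/
theorem le_proxLagrangian_iff {y : EuclideanSpace ℝ (Fin d)}
    {lam : EuclideanSpace ℝ (Fin m ⊕ Fin n)} {r c : ℝ} :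
    (c : EReal) ≤ Q.proxLagrangian y lam r ↔
      ∀ p : EuclideanSpace ℝ (Fin m ⊕ Fin n), (∀ i, Q.g (Sum.inl i) y + p (Sum.inl i) = 0) →
        (∀ j, Q.g (Sum.inr j) y + p (Sum.inr j) ≤ 0) →
        c ≤ Q.f₀ y + ∑ s, (r / 2 * p s ^ 2 - lam s * p s) := by
  unfold proxLagrangian augLagrangian
  refine le_iInf_iff.trans (forall_congr' fun p => ?_)
  have hval : Q.f₀ y - inner ℝ lam p + r * (‖p‖ ^ 2 / 2) =
      Q.f₀ y + ∑ s, (r / 2 * p s ^ 2 - lam s * p s) := by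
    rw [EuclideanSpace.real_norm_sq_eq, PiLp.inner_apply, Finset.sum_sub_distrib, ← Finset.mul_sum]
    simp only [RCLike.inner_apply, conj_trivial, mul_comm (p _)]
    ring
  by_cases hp : (∀ i, Q.g (Sum.inl i) y + p (Sum.inl i) = 0) ∧
      (∀ j, Q.g (Sum.inr j) y + p (Sum.inr j) ≤ 0)
  · rw [param, if_pos hp, ← EReal.coe_sub, ← EReal.coe_add, EReal.coe_le_coe_iff, hval]
    exact ⟨fun h _ _ => h, fun h => h hp.1 hp.2⟩
  · rw [param, if_neg hp, EReal.top_sub_coe, EReal.top_add_coe]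
    exact ⟨fun _ h1 h2 => absurd ⟨h1, h2⟩ hp, fun _ => le_top⟩

theorem extObjective_eq {x : EuclideanSpace ℝ (Fin d)} (hx : x ∈ Q.feasible) :
    Q.extObjective x = (Q.f₀ x : EReal) := by
  unfold extObjective param
  exact if_pos ⟨by simpa using hx.1, by simpa using hx.2.1⟩

theorem proxLagrangian_le_extObjective (x : EuclideanSpace ℝ (Fin d))
    (lam : EuclideanSpace ℝ (Fin m ⊕ Fin n)) (r : ℝ) :
    Q.proxLagrangian x lam r ≤ Q.extObjective x := by
  refine (iInf_le _ 0).trans ?_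
  simp [extObjective]

theorem isC11At_lagrangian {x : EuclideanSpace ℝ (Fin d)} (hf : IsC11At Q.f₀ x)
    (hg : ∀ s, IsC11At (Q.g s) x) (lam : EuclideanSpace ℝ (Fin m ⊕ Fin n)) :
    IsC11At (fun y => Q.lagrangian y lam) x :=
  hf.add (IsC11At.sum Finset.univ fun s => (hg s).const_mul (lam s))

variable {Q}

theorem IsKKTPair.eq_zero_of_notMem_activePos {x : EuclideanSpace ℝ (Fin d)}
    {lam : EuclideanSpace ℝ (Fin m ⊕ Fin n)} (h : Q.IsKKTPair x lam) {j : Fin n}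
    (hj : j ∉ Q.activePos x lam) : lam (Sum.inr j) = 0 := by
  obtain ⟨hmul, hnn⟩ := h.2.1 j
  by_contra hne
  exact hj ⟨(mul_eq_zero.1 hmul).resolve_left hne, lt_of_le_of_ne hnn (Ne.symm hne)⟩

theorem IsKKTPair.lagrangian_eq {x : EuclideanSpace ℝ (Fin d)}
    {lam : EuclideanSpace ℝ (Fin m ⊕ Fin n)} (h : Q.IsKKTPair x lam) :
    Q.lagrangian x lam = Q.f₀ x := by
  rw [lagrangian, add_eq_left]
  refine Finset.sum_eq_zero fun s _ => ?_
  rcases s with i | j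
  · rw [h.1.1 i, mul_zero]
  · exact (h.2.1 j).1

/-- The contingent cone to the whole space is the whole space, and so contains the opposite of the
gradient. -/
theorem IsKKTPair.gradient_lagrangian_eq_zero {x : EuclideanSpace ℝ (Fin d)}
    {lam : EuclideanSpace ℝ (Fin m ⊕ Fin n)} (h : Q.IsKKTPair x lam) (hA : Q.A = univ) :
    gradient (fun y => Q.lagrangian y lam) x = 0 := by
  have := h.2.2 (-gradient (fun y => Q.lagrangian y lam) x) (by
    rw [hA, posTangentConeAt_univ]
    trivial)
  rw [inner_neg_right, Left.nonneg_neg_iff] at this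
  exact inner_self_eq_zero.1 (this.antisymm real_inner_self_nonneg)

/-- At a KKT pair the infimum defining the proximal Lagrangian is attained at `p = 0`. -/
theorem IsKKTPair.proxLagrangian_eq {x : EuclideanSpace ℝ (Fin d)}
    {lam : EuclideanSpace ℝ (Fin m ⊕ Fin n)} (h : Q.IsKKTPair x lam) {r : ℝ} (hr : 0 ≤ r) :
    Q.proxLagrangian x lam r = Q.extObjective x := by
  refine (Q.proxLagrangian_le_extObjective x lam r).antisymm ?_
  rw [Q.extObjective_eq h.1, le_proxLagrangian_iff]
  intro p hpe hpi
  refine le_add_of_nonneg_right (Finset.sum_nonneg fun s _ => ?_)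
  have hsq : 0 ≤ r / 2 * p s ^ 2 := by positivity
  rcases s with i | j
  · have : p (Sum.inl i) = 0 := by simpa [h.1.1 i] using hpe i
    simp [this]
  · by_cases hj : j ∈ Q.activePos x lam
    · have hp : p (Sum.inr j) ≤ 0 := by simpa [hj.1] using hpi j
      linarith [mul_nonpos_of_nonneg_of_nonpos hj.2.le hp]
    · rw [h.eq_zero_of_notMem_activePos hj]
      simpa using hsq

open scoped Classical in
/-- The constraints kept in the quadratic penalty: the equality constraints and the active
inequality constraints with a positive multiplier. -/
noncomputable def penalized (Q : NLP d m n) (x : EuclideanSpace ℝ (Fin d))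
    (lam : EuclideanSpace ℝ (Fin m ⊕ Fin n)) : Finset (Fin m ⊕ Fin n) :=
  Finset.univ.filter fun s => ∀ j, s = Sum.inr j → j ∈ Q.activePos x lam

theorem inl_mem_penalized (x : EuclideanSpace ℝ (Fin d))
    (lam : EuclideanSpace ℝ (Fin m ⊕ Fin n)) (i : Fin m) : Sum.inl i ∈ Q.penalized x lam := by
  simp [penalized]

theorem inr_mem_penalized {x : EuclideanSpace ℝ (Fin d)}
    {lam : EuclideanSpace ℝ (Fin m ⊕ Fin n)} {j : Fin n} :
    Sum.inr j ∈ Q.penalized x lam ↔ j ∈ Q.activePos x lam := by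
  simp [penalized]

/-- Near a KKT point the proximal Lagrangian is bounded below by the Lagrangian plus the quadratic
penalty. The neighbourhood depends on `r`: in it, `-g j y ≤ lam j / r` for all penalized inequality
constraints `j`, so that `r / 2 * p ^ 2 - lam j * p` decreases on `p ≤ -g j y` and its minimum there
is attained at the endpoint. The other inequality constraints have a zero multiplier and contribute
nonnegative terms. -/
theorem IsKKTPair.eventually_le_proxLagrangian {x : EuclideanSpace ℝ (Fin d)}
    {lam : EuclideanSpace ℝ (Fin m ⊕ Fin n)} (h : Q.IsKKTPair x lam)
    (hg : ∀ s, ContinuousAt (Q.g s) x) {r : ℝ} (hr : 0 ≤ r) :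
    ∀ᶠ y in 𝓝 x, ((Q.lagrangian y lam + r / 2 * ∑ s ∈ Q.penalized x lam, Q.g s y ^ 2 : ℝ) : EReal)
      ≤ Q.proxLagrangian y lam r := by
  have hev : ∀ᶠ y in 𝓝 x, ∀ j ∈ Q.activePos x lam, r * -Q.g (Sum.inr j) y ≤ lam (Sum.inr j) := by
    refine Filter.eventually_all.2 fun j => ?_
    by_cases hj : j ∈ Q.activePos x lam
    · have hlim : Tendsto (fun y => r * -Q.g (Sum.inr j) y) (𝓝 x) (𝓝 0) := by
        simpa [hj.1] using ((hg (Sum.inr j)).tendsto.neg).const_mul r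
      filter_upwards [hlim.eventually (gt_mem_nhds hj.2)] with y hy _
      exact hy.le
    · exact Eventually.of_forall fun y hj' => absurd hj' hj
  filter_upwards [hev] with y hy
  rw [le_proxLagrangian_iff]
  intro p hpe hpi
  classical
  rw [lagrangian, add_assoc, Finset.mul_sum, ← Finset.univ_inter (Q.penalized x lam),
    ← Finset.sum_ite_mem, ← Finset.sum_add_distrib]
  refine add_le_add_right (Finset.sum_le_sum fun s _ => ?_) _
  have hsq : 0 ≤ r / 2 * p s ^ 2 := by positivity
  rcases s with i | j
  · have hp : p (Sum.inl i) = -Q.g (Sum.inl i) y := by linarith [hpe i]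
    rw [if_pos (inl_mem_penalized x lam i), hp]
    exact le_of_eq (by ring)
  · by_cases hj : j ∈ Q.activePos x lam
    · rw [if_pos (inr_mem_penalized.2 hj)]
      -- With `q = -g j y`, the difference of the two sides is `(q - p) * (lam - r * (q + p) / 2)`.
      have hq : 0 ≤ -Q.g (Sum.inr j) y - p (Sum.inr j) := by linarith [hpi j]
      have hfac : 0 ≤ lam (Sum.inr j) - r * (-Q.g (Sum.inr j) y + p (Sum.inr j)) / 2 := by
        linarith [hy j hj, mul_nonneg hr hq]
      linarith [mul_nonneg hq hfac]
    · rw [if_neg (mt inr_mem_penalized.1 hj), h.eq_zero_of_notMem_activePos hj]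
      simpa using hsq

end NLP

theorem mainTheorem7 {d m n : ℕ} (Q : NLP d m n) (hA : Q.A = Set.univ)
    (x : EuclideanSpace ℝ (Fin d)) (lam : EuclideanSpace ℝ (Fin m ⊕ Fin n))
    (hx : Q.IsLocallyOptimal x)
    (hf : IsC11At Q.f₀ x) (hg : ∀ s, IsC11At (Q.g s) x)
    (hKKT : Q.IsKKTPair x lam)
    (hSC : Q.StrictComplementarity x lam)
    (hSOSC : Q.GeneralizedSOSC x lam) :
    Q.IsLocalAugMultiplier x lam := by
  obtain ⟨r₀, hr₀, hpen⟩ := (Q.isC11At_lagrangian hf hg lam).exists_eventually_le_add_penalty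
    (S := Q.penalized x lam) (g := Q.g) (hKKT.gradient_lagrangian_eq_zero hA)
    (fun s _ => (hg s).differentiableAt)
    (fun s hs => by
      rcases s with i | j
      · exact hKKT.1.1 i
      · exact (NLP.inr_mem_penalized.1 hs).1)
    (fun v hv hv0 M hM => hSOSC M hM v
      ⟨fun i => hv _ (NLP.inl_mem_penalized x lam i),
        fun j hj => hv _ (NLP.inr_mem_penalized.2 hj)⟩ hv0)
  refine ⟨2 * r₀, by positivity, fun r hr => ?_⟩
  have hr' : 0 ≤ r := le_trans (by positivity) hr
  have heq := hKKT.proxLagrangian_eq hr'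
  refine ⟨IsLocalMin.on ?_ _, heq⟩
  filter_upwards [hpen, hKKT.eventually_le_proxLagrangian
    (fun s => (hg s).differentiableAt.continuousAt) hr'] with y hy1 hy2
  rw [heq, Q.extObjective_eq hKKT.1]
  refine le_trans (EReal.coe_le_coe_iff.2 ?_) hy2
  rw [← hKKT.lagrangian_eq]
  refine hy1.trans (add_le_add_right (mul_le_mul_of_nonneg_right (by linarith) ?_) _)
  exact Finset.sum_nonneg fun s _ => sq_nonneg _
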